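/- Let $\log$ denote the logarithm to base $2$. For integers $n,k,d,m$, an $(n,k,d)$ linear injector of size $m$ is a family $A_1,\dots,A_m$ of $d\times n$ matrices over $\mathbb F_2$ such that for every subspace $U\subseteq\mathbb F_2^n$ of dimension $k$ there is an $i$ with $\ker(A_i)\cap U=\{0\}$. A function $f:\mathbb F_2^n\to\mathbb F_2$ is an affine extractor for dimension $k$ with bias $\varepsilon$ if for every affine subspace $u_0+U\subseteq\mathbb F_2^n$ of dimension $k$, the distribution of $f(x)$, for $x$ uniform in $u_0+U$, is within statistical distance $\varepsilon$ of the uniform distribution over $\mathbb F_2$. The degree of $f$ is the total degree of the unique multilinear polynomial over $\mathbb F_2$ that agrees with $f$. An XOR-AND-XOR circuit has unbounded fan-in and consists of a layer of XOR gates on literals, a layer of AND gates on these, and a top XOR gate; a De Morgan formula has literals at its leaves and AND and OR gates of fan-in $2$ and fan-out $1$; size is the number of gates. Theorem. There are universal constants $n_0,c,C$ such that the following holds for every integer $n>n_0$ and every $0<\varepsilon\le 1$. Put $L=\log(n/\varepsilon^2)+\log\log(n/\varepsilon^2)$ and $k=\lceil L+c\rceil$, and suppose that $k\le n$. Then there exists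 an $(n,k,k+1)$ linear injector of size $nk$, and for every such injector $A_1,\dots,A_{nk}$ there are functions $f_1,\dots,f_{nk}:\mathbb F_2^{k+1}\to\mathbb F_2$ such that the function $f:\mathbb F_2^n\to\mathbb F_2$, $f(x)=\bigoplus_{i=1}^{nk} f_i(A_i x)$, is an affine extractor for dimension $k$ with bias $\varepsilon$ and, moreover: 1. $|\deg(f)-L|\le C$; 2. $f$ is computed by an XOR-AND-XOR circuit of size at most $C\,(n/\varepsilon)^2\log^3(n/\varepsilon)$; 3. $f$ is computed by a De Morgan formula of size at most $C\,(n^5/\varepsilon^2)\log^3(n/\varepsilon)$. -/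

import Mathlib

/-- The field with two elements; `1` is identified with the Boolean value `true`. -/
abbrev F2 : Type := ZMod 2

/-! ### Affine extractors -/

/-- Statistical distance of two distributions on a finite set `D`, given by their mass functions:
the maximum over all events `A ⊆ D` of `|p(A) - q(A)|`. -/
noncomputable def statDist {D : Type} [Fintype D] (p q : D → ℝ) : ℝ :=
  ⨆ A : Finset D, |∑ a ∈ A, p a - ∑ a ∈ A, q a|

/-- The distribution of `f x`, for `x` uniformly distributed over the (finite, nonempty) set `S`. -/
noncomputable def outputDist {n : ℕ} (f : (Fin n → F2) → F2) (S : Set (Fin n → F2)) : F2 → ℝ :=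
  fun b => ({x ∈ S | f x = b}.ncard : ℝ) / (S.ncard : ℝ)

/-- The uniform distribution over `F2`. -/
noncomputable def uniformF2 : F2 → ℝ := fun _ => 1 / (Fintype.card F2 : ℝ)

/-- The affine subspace `u₀ + U`. -/
def affineCoset {n : ℕ} (u₀ : Fin n → F2) (U : Submodule F2 (Fin n → F2)) : Set (Fin n → F2) :=
  (fun u => u₀ + u) '' (U : Set (Fin n → F2))

/-- `f` is an affine extractor for dimension `k` with bias `ε`. -/
def IsAffineExtractor {n : ℕ} (f : (Fin n → F2) → F2) (k : ℕ) (ε : ℝ) : Prop :=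
  ∀ (u₀ : Fin n → F2) (U : Submodule F2 (Fin n → F2)), Module.finrank F2 U = k →
    statDist (outputDist f (affineCoset u₀ U)) uniformF2 ≤ ε

/-! ### Linear injectors -/

/-- The family `A 0, …, A (m - 1)` of `d × n` matrices is an `(n, k, d)` linear injector (with
size `m`): every `k`-dimensional subspace meets the kernel of some `A i` only in `0`. -/
def IsLinearInjector {n d m : ℕ} (k : ℕ) (A : Fin m → Matrix (Fin d) (Fin n) F2) : Prop :=
  ∀ U : Submodule F2 (Fin n → F2), Module.finrank F2 U = k →
    ∃ i, LinearMap.ker (A i).mulVecLin ⊓ U = ⊥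

/-- The function `x ↦ f₁(A₁ x) ⊕ ⋯ ⊕ f_m(A_m x)`. -/
def xorConstruction {n d m : ℕ} (A : Fin m → Matrix (Fin d) (Fin n) F2)
    (fs : Fin m → (Fin d → F2) → F2) : (Fin n → F2) → F2 :=
  fun x => ∑ i, fs i ((A i).mulVec x)

/-! ### Degree of a function -/

/-- Every function `F2ⁿ → F2` agrees with exactly one multilinear polynomial. -/
theorem existsUnique_multilinear {n : ℕ} (f : (Fin n → F2) → F2) :
    ∃! p : MvPolynomial (Fin n) F2,
      p ∈ MvPolynomial.restrictDegree (Fin n) F2 1 ∧ ∀ x, MvPolynomial.eval x p = f x := by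
  have hc : Fintype.card F2 - 1 = 1 := by decide
  have hs := MvPolynomial.map_restrict_dom_evalₗ F2 (Fin n)
  rw [hc] at hs
  obtain ⟨p, hp, hpf⟩ : f ∈ (MvPolynomial.restrictDegree (Fin n) F2 1).map
      (MvPolynomial.evalₗ F2 (Fin n)) := by rw [hs]; trivial
  have hpe : ∀ x, MvPolynomial.eval x p = f x := fun x => congrFun hpf x
  refine ⟨p, ⟨hp, hpe⟩, ?_⟩
  rintro q ⟨hq, hqe⟩
  refine sub_eq_zero.mp (MvPolynomial.eq_zero_of_eval_eq_zero (Fin n) F2 (q - p) ?_ ?_)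
  · intro v
    rw [map_sub, hqe, hpe, sub_self]
  · rw [hc]
    exact Submodule.sub_mem _ hq hp

/-- The degree of a function `F2ⁿ → F2`: the total degree of the unique multilinear polynomial
that agrees with it. -/
noncomputable def funDegree {n : ℕ} (f : (Fin n → F2) → F2) : ℕ :=
  (existsUnique_multilinear f).choose.totalDegree

/-! ### Circuits and formulas -/

/-- A literal: `(i, false)` is the variable `xᵢ`, `(i, true)` is its negation. -/
abbrev Literal (n : ℕ) : Type := Fin n × Bool

/-- The value of a literal. -/
def Literal.eval {n : ℕ} (l : Literal n) (x : Fin n → F2) : F2 :=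
  if l.2 then x l.1 + 1 else x l.1

/-- An XOR-AND-XOR circuit on `n` inputs, with unbounded fan-in and unbounded fan-out: XOR gates
on literals, then AND gates on these XOR gates, then one XOR gate on the AND gates. -/
structure XAXCircuit (n : ℕ) where
  /-- number of XOR gates in the bottom layer -/
  numXor : ℕ
  /-- number of AND gates in the middle layer -/
  numAnd : ℕ
  /-- the inputs of each XOR gate of the bottom layer -/
  xorIn : Fin numXor → Finset (Literal n)
  /-- the inputs of each AND gate -/
  andIn : Fin numAnd → Finset (Fin numXor)
  /-- the inputs of the top XOR gate -/
  topIn : Finset (Fin numAnd)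

/-- The size of a circuit is its number of gates. -/
def XAXCircuit.size {n : ℕ} (C : XAXCircuit n) : ℕ := C.numXor + C.numAnd + 1

/-- The function computed by the circuit (over `F2`, XOR is the sum and AND is the product). -/
def XAXCircuit.eval {n : ℕ} (C : XAXCircuit n) (x : Fin n → F2) : F2 :=
  ∑ j ∈ C.topIn, ∏ g ∈ C.andIn j, ∑ l ∈ C.xorIn g, Literal.eval l x

/-- De Morgan formulas on `n` inputs: AND and OR gates of fan-in two and fan-out one, with
literals at the leaves. -/
inductive DeMorganFormula (n : ℕ) : Type
  | pos (i : Fin n) : DeMorganFormula n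
  | neg (i : Fin n) : DeMorganFormula n
  | and (φ ψ : DeMorganFormula n) : DeMorganFormula n
  | or (φ ψ : DeMorganFormula n) : DeMorganFormula n

/-- The size of a formula is its number of gates. -/
def DeMorganFormula.size {n : ℕ} : DeMorganFormula n → ℕ
  | .pos _ => 0
  | .neg _ => 0
  | .and φ ψ => φ.size + ψ.size + 1
  | .or φ ψ => φ.size + ψ.size + 1

/-- The Boolean function computed by a formula. -/
def DeMorganFormula.eval {n : ℕ} (x : Fin n → Bool) : DeMorganFormula n → Bool
  | .pos i => x i
  | .neg i => !(x i)
  | .and φ ψ => φ.eval x && ψ.eval x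
  | .or φ ψ => φ.eval x || ψ.eval x

/-- The circuit `C` computes `f`. -/
def XAXCircuit.Computes {n : ℕ} (C : XAXCircuit n) (f : (Fin n → F2) → F2) : Prop :=
  ∀ x, C.eval x = f x

/-- The formula `φ` computes `f`. -/
def DeMorganFormula.Computes {n : ℕ} (φ : DeMorganFormula n) (f : (Fin n → F2) → F2) : Prop :=
  ∀ x, φ.eval (fun i => decide (x i = 1)) = decide (f x = 1)

/-- The quantity `log (n / ε²) + log log (n / ε²)`, with logarithms to base `2`. -/
noncomputable def dimBound (n : ℕ) (ε : ℝ) : ℝ :=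
  Real.logb 2 (n / ε ^ 2) + Real.logb 2 (Real.logb 2 (n / ε ^ 2))

/-!
Everything follows from a uniformly random choice of the functions `fᵢ`; put `N = n / ε²`, so that
`2 ^ dimBound n ε = N log N`, and let `k` exceed `dimBound n ε` by `3`, up to rounding.

*Injector.* A random `(k + 1) × n` matrix kills a given nonzero vector with probability
`2 ^ -(k + 1)`, hence fails to be injective on a given `k`-dimensional space with probability below
`1 / 2`. All `n k` matrices fail with probability below `2 ^ -(n k)`, and there are at most
`2 ^ (n k)` spaces (`exists_isLinearInjector`).

*Extractor.* On a coset `u₀ + U` some `Aᵢ` is injective, so `fᵢ` alone produces every function there.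
The restriction map `fs ↦ f|_(u₀ + U)` is thus a surjective homomorphism, and the restriction of the
random `f` is a uniformly random function on `2 ^ k` points (`restrictionHom_surjective`). By
Hoeffding's inequality (`card_sum_bitSign_gt_le`) its bias exceeds `ε` with probability at most
`2 exp (-2 ε² 2 ^ k)`. There are at most `2 ^ (n (k + 1))` cosets, and `ε² 2 ^ k ≥ 8 n log N`
beats `n (k + 1)`, so the total failure probability is below `1 / 2` (`union_bound_lt_half`).

*Degree.* Composition with linear maps does not raise the degree, so `deg f ≤ k + 1`. Conversely a
function of degree below `k` sums to zero over each `k`-dimensional space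
(`sum_submodule_eq_zero`), and for one fixed such space this happens with probability exactly
`1 / 2`. Hence some choice of `fs` gives an extractor of degree `k` or `k + 1`
(`exists_isAffineExtractor_le_funDegree`).

*Circuits and formulas.* Here the `fᵢ` may be arbitrary. As a sum of point indicators, `fᵢ (Aᵢ x)` is
an XOR of `2 ^ (k + 1)` products of affine forms (`exists_xaxCircuit_xorConstruction`). A formula for
the XOR of `m` functions costs a factor `4 m²` in the number of leaves (`HasFormula.sum`), and a
decision tree for `fᵢ` costs a factor of about `2 ^ (k + 2)` (`HasFormula.comp`); the XORs of
`n` variables, the tree and the outer XOR together give `O(n² · 2 ^ k · (n k)²)` leaves.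
-/

/-! ### Counting along surjective homomorphisms -/

theorem card_filter_comp_mul_card {G H : Type*} [AddGroup G] [AddGroup H] [Fintype G]
    [Fintype H] (φ : G →+ H) (hφ : Function.Surjective φ) (P : H → Prop) [DecidablePred P] :
    (Finset.univ.filter fun g => P (φ g)).card * Fintype.card H =
      (Finset.univ.filter P).card * Fintype.card G := by
  classical
  have hfib (h : H) : (Finset.univ.filter fun g => φ g = h).card =
      (Finset.univ.filter fun g => φ g = 0).card :=
    AddMonoidHom.card_fiber_eq_of_mem_range φ (hφ h) (hφ 0)
  have hG : Fintype.card G = Fintype.card H * (Finset.univ.filter fun g => φ g = 0).card := by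
    rw [← Finset.card_univ, Finset.card_eq_sum_card_fiberwise (f := φ) (t := Finset.univ)
      (fun _ _ => Finset.mem_coe.2 (Finset.mem_univ _))]
    simp [hfib]
  have hP : (Finset.univ.filter fun g => P (φ g)).card =
      (Finset.univ.filter P).card * (Finset.univ.filter fun g => φ g = 0).card := by
    rw [Finset.card_eq_sum_card_fiberwise (f := φ) (t := Finset.univ.filter P)
      (fun g hg => by simpa using hg), ← smul_eq_mul, ← Finset.sum_const]
    refine Finset.sum_congr rfl fun h hh => ?_
    rw [← hfib h, Finset.filter_filter]
    congr 1
    ext g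
    simp only [Finset.mem_filter, Finset.mem_univ, true_and] at hh ⊢
    exact ⟨fun h => h.2, fun h => ⟨h ▸ hh, h⟩⟩
  rw [hP, hG]
  ring

/-! ### Existence of linear injectors -/

/-- A nonzero vector lies in the kernel of a `2⁻ᵈ` fraction of all `d × n` matrices. -/
theorem card_mulVec_eq_zero {d n : ℕ} {u : Fin n → F2} (hu : u ≠ 0) :
    (Finset.univ.filter fun M : Matrix (Fin d) (Fin n) F2 => M.mulVec u = 0).card * 2 ^ d =
      Fintype.card (Matrix (Fin d) (Fin n) F2) := by
  let φ : Matrix (Fin d) (Fin n) F2 →+ (Fin d → F2) :=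
    { toFun := fun M => M.mulVec u
      map_zero' := Matrix.zero_mulVec u
      map_add' := fun M N => Matrix.add_mulVec M N u }
  have hφ : Function.Surjective φ := by
    intro y
    obtain ⟨j, hj⟩ := Function.ne_iff.1 hu
    refine ⟨Matrix.of fun i l => if l = j then y i * (u j)⁻¹ else 0, ?_⟩
    ext i
    have hj' : u j ≠ 0 := hj
    simp [φ, Matrix.mulVec, dotProduct, hj']
  have h := card_filter_comp_mul_card φ hφ fun y => y = 0
  simpa [φ, Finset.filter_eq', ZMod.card] using h

/-- Over half of all `(k + 1) × n` matrices are injective on a given space with at most `2ᵏ`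
elements. -/
theorem two_mul_card_not_injective_lt {k n : ℕ} (U : Submodule F2 (Fin n → F2))
    (hU : Module.finrank F2 U ≤ k)
    [DecidablePred fun M : Matrix (Fin (k + 1)) (Fin n) F2 => LinearMap.ker M.mulVecLin ⊓ U ≠ ⊥] :
    2 * (Finset.univ.filter fun M : Matrix (Fin (k + 1)) (Fin n) F2 =>
      LinearMap.ker M.mulVecLin ⊓ U ≠ ⊥).card < Fintype.card (Matrix (Fin (k + 1)) (Fin n) F2) := by
  classical
  set B := Finset.univ.filter fun M : Matrix (Fin (k + 1)) (Fin n) F2 =>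
      LinearMap.ker M.mulVecLin ⊓ U ≠ ⊥
  set T := Finset.univ.filter fun u : Fin n → F2 => u ∈ U ∧ u ≠ 0
  have hsub : B ⊆ T.biUnion fun u => Finset.univ.filter fun M => M.mulVec u = 0 := by
    intro M hM
    obtain ⟨u, hu, hu0⟩ := Submodule.exists_mem_ne_zero_of_ne_bot (Finset.mem_filter.1 hM).2
    simp only [Finset.mem_biUnion, Finset.mem_filter, Finset.mem_univ, true_and, T]
    exact ⟨u, ⟨hu.2, hu0⟩, by simpa using hu.1⟩
  have hT : T.card < 2 ^ k := by
    have hcard : Fintype.card U ≤ 2 ^ k := by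
      rw [Module.card_eq_pow_finrank (K := F2), ZMod.card]
      exact Nat.pow_le_pow_right (by norm_num) hU
    have : T.card < (Finset.univ.filter fun u : Fin n → F2 => u ∈ U).card := by
      refine Finset.card_lt_card ⟨fun u hu => ?_, fun h => ?_⟩
      · simp only [T, Finset.mem_filter] at hu ⊢
        exact ⟨hu.1, hu.2.1⟩
      · have := h (show (0 : Fin n → F2) ∈ _ by simp)
        simp [T] at this
    rw [Fintype.card_subtype] at hcard
    exact this.trans_le hcard
  have hB : B.card * 2 ^ (k + 1) ≤ T.card * Fintype.card (Matrix (Fin (k + 1)) (Fin n) F2) := by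
    refine (Nat.mul_le_mul_right _ ((Finset.card_le_card hsub).trans Finset.card_biUnion_le)).trans ?_
    rw [Finset.sum_mul, Finset.sum_congr rfl fun u hu =>
      card_mulVec_eq_zero (Finset.mem_filter.1 hu).2.2]
    simp
  have hpos : 0 < Fintype.card (Matrix (Fin (k + 1)) (Fin n) F2) := Fintype.card_pos
  have h1 := (Nat.mul_lt_mul_right hpos).2 hT
  refine lt_of_mul_lt_mul_left ?_ (Nat.zero_le (2 ^ k))
  calc 2 ^ k * (2 * B.card) = B.card * 2 ^ (k + 1) := by ring
    _ ≤ _ := hB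
    _ < _ := h1

theorem exists_tuple_span_eq {k n : ℕ} {U : Submodule F2 (Fin n → F2)}
    (hU : Module.finrank F2 U = k) :
    ∃ v : Fin k → (Fin n → F2), Submodule.span F2 (Set.range v) = U := by
  let b := Module.finBasisOfFinrankEq F2 U hU
  refine ⟨fun i => b i, ?_⟩
  have : Set.range (fun i => (b i : Fin n → F2)) = U.subtype '' Set.range b := by
    rw [← Set.range_comp]; rfl
  rw [this, Submodule.span_image, b.span_eq, Submodule.map_top, Submodule.range_subtype]

/-- A union bound over spanning `k`-tuples: all `n * k` random matrices fail on a given space with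
probability below `2⁻ⁿᵏ`. -/
theorem exists_isLinearInjector {n k : ℕ} (hn : 0 < n) (hk : 0 < k) :
    ∃ A : Fin (n * k) → Matrix (Fin (k + 1)) (Fin n) F2, IsLinearInjector k A := by
  classical
  let W (v : Fin k → Fin n → F2) := Submodule.span F2 (Set.range v)
  let B (v : Fin k → Fin n → F2) := Finset.univ.filter
    fun M : Matrix (Fin (k + 1)) (Fin n) F2 => LinearMap.ker M.mulVecLin ⊓ W v ≠ ⊥
  have hB (v) : 2 * (B v).card < Fintype.card (Matrix (Fin (k + 1)) (Fin n) F2) :=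
    two_mul_card_not_injective_lt _ ((finrank_range_le_card v).trans_eq (Fintype.card_fin k))
  let bad := Finset.univ.biUnion fun v : Fin k → Fin n → F2 =>
    Fintype.piFinset fun _ : Fin (n * k) => B v
  have hbad : bad.card < Fintype.card (Fin (n * k) → Matrix (Fin (k + 1)) (Fin n) F2) := by
    have hnk : n * k ≠ 0 := (Nat.mul_pos hn hk).ne'
    have hcard : bad.card ≤ ∑ v : Fin k → Fin n → F2, (B v).card ^ (n * k) := by
      refine Finset.card_biUnion_le.trans_eq ?_
      simp [Fintype.card_piFinset]
    have hlt : ∑ v : Fin k → Fin n → F2, (2 * (B v).card) ^ (n * k) <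
        ∑ _v : Fin k → Fin n → F2,
          Fintype.card (Matrix (Fin (k + 1)) (Fin n) F2) ^ (n * k) :=
      Finset.sum_lt_sum_of_nonempty Finset.univ_nonempty
        fun v _ => Nat.pow_lt_pow_left (hB v) hnk
    have hv : Fintype.card (Fin k → Fin n → F2) = 2 ^ (n * k) := by
      simp [ZMod.card, pow_mul]
    simp only [mul_pow, ← Finset.mul_sum, Finset.sum_const, Finset.card_univ, hv,
      smul_eq_mul] at hlt
    rw [Fintype.card_fun, Fintype.card_fin]
    exact hcard.trans_lt (Nat.lt_of_mul_lt_mul_left hlt)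
  obtain ⟨A, hA⟩ : ∃ A, A ∉ bad := by
    by_contra! h
    exact hbad.ne (Finset.card_eq_iff_eq_univ _ |>.2 (Finset.eq_univ_iff_forall.2 h))
  refine ⟨A, fun U hU => ?_⟩
  obtain ⟨v, hv⟩ := exists_tuple_span_eq hU
  by_contra! h
  refine hA (Finset.mem_biUnion.2 ⟨v, Finset.mem_univ _, Fintype.mem_piFinset.2 fun i => ?_⟩)
  simpa [B, W, hv] using h i

/-! ### Concentration of random bits -/

/-- The sign `(-1)ᵇ`. -/
noncomputable def bitSign (b : F2) : ℝ := if b = 0 then 1 else -1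

/-- Hoeffding's bound for `|ι|` independent uniform bits, as a count of bit vectors. -/
theorem card_sum_bitSign_gt_le {ι : Type*} [Fintype ι] [DecidableEq ι] {ε : ℝ} (hε : 0 ≤ ε)
    [DecidablePred fun g : ι → F2 => 2 * ε * Fintype.card ι < |∑ i, bitSign (g i)|] :
    ((Finset.univ.filter fun g : ι → F2 =>
        2 * ε * Fintype.card ι < |∑ i, bitSign (g i)|).card : ℝ) ≤
      2 * Real.exp (-(2 * ε ^ 2 * Fintype.card ι)) * 2 ^ Fintype.card ι := by
  let B := Finset.univ.filter fun g : ι → F2 => 2 * ε * Fintype.card ι < |∑ i, bitSign (g i)|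
  have hmgf (t : ℝ) (ht : t ^ 2 = (2 * ε) ^ 2) :
      ∑ g : ι → F2, Real.exp (t * ∑ i, bitSign (g i) - 4 * ε ^ 2 * Fintype.card ι) ≤
        Real.exp (-(2 * ε ^ 2 * Fintype.card ι)) * 2 ^ Fintype.card ι := by
    have hprod : ∑ g : ι → F2, Real.exp (t * ∑ i, bitSign (g i)) = (2 * Real.cosh t) ^ Fintype.card ι := by
      have hbit : ∑ b : F2, Real.exp (t * bitSign b) = 2 * Real.cosh t := by
        rw [Real.cosh_eq, show (Finset.univ : Finset F2) = {0, 1} from rfl,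
          Finset.sum_pair (by decide)]
        simp [bitSign]
        ring
      simp only [Finset.mul_sum, Real.exp_sum]
      rw [← hbit, ← Fintype.piFinset_univ,
        ← Finset.prod_univ_sum (fun _ => Finset.univ) fun (_ : ι) b => Real.exp (t * bitSign b)]
      simp
    simp only [sub_eq_add_neg, Real.exp_add]
    rw [← Finset.sum_mul, hprod]
    calc (2 * Real.cosh t) ^ Fintype.card ι * Real.exp (-(4 * ε ^ 2 * Fintype.card ι))
        ≤ (2 * Real.exp (t ^ 2 / 2)) ^ Fintype.card ι * Real.exp (-(4 * ε ^ 2 * Fintype.card ι)) := by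
          gcongr
          exact Real.cosh_le_exp_half_sq t
      _ = Real.exp (-(2 * ε ^ 2 * Fintype.card ι)) * 2 ^ Fintype.card ι := by
          rw [mul_pow, ← Real.exp_nat_mul, mul_assoc, ← Real.exp_add, ht, mul_comm]
          ring_nf
  -- The parameter `2 ε` is optimal in the exponential moment method.
  have hone (g : ι → F2) (hg : g ∈ B) :
      1 ≤ Real.exp (2 * ε * ∑ i, bitSign (g i) - 4 * ε ^ 2 * Fintype.card ι) +
        Real.exp (-(2 * ε) * ∑ i, bitSign (g i) - 4 * ε ^ 2 * Fintype.card ι) := by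
    have hg' := (Finset.mem_filter.1 hg).2
    rcases lt_abs.1 hg' with h | h
    · refine le_add_of_le_of_nonneg (Real.one_le_exp ?_) (Real.exp_pos _).le
      nlinarith
    · refine le_add_of_nonneg_of_le (Real.exp_pos _).le (Real.one_le_exp ?_)
      nlinarith
  calc (B.card : ℝ) = ∑ g ∈ B, 1 := by simp
    _ ≤ ∑ g ∈ B, (Real.exp (2 * ε * ∑ i, bitSign (g i) - 4 * ε ^ 2 * Fintype.card ι) +
        Real.exp (-(2 * ε) * ∑ i, bitSign (g i) - 4 * ε ^ 2 * Fintype.card ι)) :=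
      Finset.sum_le_sum fun g hg => hone g hg
    _ ≤ ∑ g : ι → F2, (Real.exp (2 * ε * ∑ i, bitSign (g i) - 4 * ε ^ 2 * Fintype.card ι) +
        Real.exp (-(2 * ε) * ∑ i, bitSign (g i) - 4 * ε ^ 2 * Fintype.card ι)) :=
      Finset.sum_le_univ_sum_of_nonneg fun g => by positivity
    _ ≤ _ := by
      rw [Finset.sum_add_distrib]
      linarith [hmgf (2 * ε) rfl, hmgf (-(2 * ε)) (by ring)]

/-! ### Degree -/

theorem totalDegree_aeval_le {σ τ R : Type*} [CommRing R] [Nontrivial R]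
    (g : σ → MvPolynomial τ R) (hg : ∀ i, (g i).totalDegree ≤ 1) (p : MvPolynomial σ R) :
    (MvPolynomial.aeval g p).totalDegree ≤ p.totalDegree := by
  rw [MvPolynomial.aeval_def, MvPolynomial.eval₂_eq]
  refine MvPolynomial.totalDegree_finsetSum_le fun s hs => ?_
  refine (MvPolynomial.totalDegree_mul _ _).trans ?_
  rw [MvPolynomial.algebraMap_eq, MvPolynomial.totalDegree_C, zero_add]
  refine (MvPolynomial.totalDegree_finsetProd _ _).trans
    (le_trans ?_ (MvPolynomial.le_totalDegree hs))
  refine Finset.sum_le_sum fun i _ => (MvPolynomial.totalDegree_pow _ _).trans ?_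
  simpa using Nat.mul_le_mul_left (s i) (hg i)

/-- Replacing every exponent by its minimum with `1` makes a polynomial multilinear without
changing its values over `F2`. -/
theorem funDegree_le_totalDegree {n : ℕ} {f : (Fin n → F2) → F2} (p : MvPolynomial (Fin n) F2)
    (hp : ∀ x, MvPolynomial.eval x p = f x) : funDegree f ≤ p.totalDegree := by
  classical
  let r (s : Fin n →₀ ℕ) : Fin n →₀ ℕ := s.mapRange (min 1) (by simp)
  let q := ∑ s ∈ p.support, MvPolynomial.monomial (r s) (p.coeff s)
  have hq : q ∈ MvPolynomial.restrictDegree (Fin n) F2 1 := by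
    refine Submodule.sum_mem _ fun s _ => (MvPolynomial.mem_restrictDegree _ _ _).2 fun t ht i => ?_
    have := Finset.mem_singleton.1 (MvPolynomial.support_monomial_subset ht)
    simp [this, r]
  have hpow (a : F2) (e : ℕ) : a ^ min 1 e = a ^ e := by
    rcases Nat.eq_zero_or_pos e with rfl | he
    · simp
    · rw [min_eq_left he, pow_one]
      rcases (by revert a; decide : a = 0 ∨ a = 1) with rfl | rfl
      · rw [zero_pow he.ne']
      · rw [one_pow]
  have hqe (x) : MvPolynomial.eval x q = f x := by
    rw [← hp x, MvPolynomial.eval_eq' x p]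
    simp only [q, map_sum, MvPolynomial.eval_monomial]
    refine Finset.sum_congr rfl fun s _ => ?_
    rw [Finsupp.prod_fintype _ _ (by simp)]
    simp [r, hpow]
  have huniq := (existsUnique_multilinear f).unique (existsUnique_multilinear f).choose_spec.1
    ⟨hq, hqe⟩
  rw [funDegree, huniq]
  refine MvPolynomial.totalDegree_finsetSum_le fun s hs => ?_
  refine (MvPolynomial.totalDegree_monomial_le _ _).trans
    (le_trans ?_ (MvPolynomial.le_totalDegree hs))
  rw [Finsupp.sum_fintype _ _ (by simp), Finsupp.sum_fintype _ _ (by simp)]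
  exact Finset.sum_le_sum fun i _ => by simp [r]

theorem exists_eval_eq_totalDegree_eq_funDegree {n : ℕ} (f : (Fin n → F2) → F2) :
    ∃ p : MvPolynomial (Fin n) F2, (∀ x, MvPolynomial.eval x p = f x) ∧
      p.totalDegree = funDegree f :=
  ⟨_, (existsUnique_multilinear f).choose_spec.1.2, rfl⟩

theorem funDegree_le {n : ℕ} (f : (Fin n → F2) → F2) : funDegree f ≤ n := by
  let p := (existsUnique_multilinear f).choose
  have hp : p ∈ MvPolynomial.restrictDegree (Fin n) F2 1 :=
    (existsUnique_multilinear f).choose_spec.1.1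
  refine Finset.sup_le fun s hs => ?_
  rw [Finsupp.sum_fintype _ _ (by simp)]
  refine (Finset.sum_le_sum fun i _ => (MvPolynomial.mem_restrictDegree _ _ _).1 hp s hs i).trans ?_
  simp

theorem exists_linear_polynomials {n d : ℕ} (M : (Fin n → F2) →ₗ[F2] (Fin d → F2)) :
    ∃ g : Fin d → MvPolynomial (Fin n) F2, (∀ j, (g j).totalDegree ≤ 1) ∧
      ∀ x j, MvPolynomial.eval x (g j) = M x j := by
  classical
  refine ⟨fun j => ∑ l, MvPolynomial.C (M (Pi.single l 1) j) * MvPolynomial.X l, fun j => ?_,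
    fun x j => ?_⟩
  · refine MvPolynomial.totalDegree_finsetSum_le fun l _ => (MvPolynomial.totalDegree_mul _ _).trans ?_
    simp
  · conv_rhs => rw [← Finset.univ_sum_single x, map_sum]
    simp only [map_sum, Finset.sum_apply, map_mul, MvPolynomial.eval_C, MvPolynomial.eval_X]
    refine Finset.sum_congr rfl fun l _ => ?_
    have : (Pi.single l (x l) : Fin n → F2) = x l • Pi.single l 1 := by
      rw [← Pi.single_smul]; simp
    rw [this, map_smul]
    simp [mul_comm]

/-- Composition with a linear map does not raise the degree. -/
theorem exists_eval_eq_comp_linear {n d : ℕ} (h : (Fin d → F2) → F2)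
    (M : (Fin n → F2) →ₗ[F2] (Fin d → F2)) :
    ∃ p : MvPolynomial (Fin n) F2, (∀ x, MvPolynomial.eval x p = h (M x)) ∧
      p.totalDegree ≤ funDegree h := by
  obtain ⟨q, hq, hqd⟩ := exists_eval_eq_totalDegree_eq_funDegree h
  obtain ⟨g, hg, hge⟩ := exists_linear_polynomials M
  refine ⟨MvPolynomial.aeval g q, fun x => ?_, (totalDegree_aeval_le g hg q).trans_eq hqd⟩
  rw [← hq (M x), ← funext (hge x), MvPolynomial.aeval_def, MvPolynomial.algebraMap_eq,
    MvPolynomial.eval₂_eq, MvPolynomial.eval_eq _ q]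
  simp only [map_sum, map_mul, map_prod, map_pow, MvPolynomial.eval_C]

theorem funDegree_xorConstruction_le {n d m : ℕ} (A : Fin m → Matrix (Fin d) (Fin n) F2)
    (fs : Fin m → (Fin d → F2) → F2) : funDegree (xorConstruction A fs) ≤ d := by
  choose p hp hpd using fun i => exists_eval_eq_comp_linear (fs i) (A i).mulVecLin
  refine (funDegree_le_totalDegree (∑ i, p i) fun x => ?_).trans
    (MvPolynomial.totalDegree_finsetSum_le fun i _ => (hpd i).trans (funDegree_le _))
  simp [hp, xorConstruction]

/-- A function of degree below `k` sums to zero over every `k`-dimensional subspace. -/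
theorem sum_submodule_eq_zero {n k : ℕ} {f : (Fin n → F2) → F2} (hf : funDegree f < k)
    (U : Submodule F2 (Fin n → F2)) [Fintype U] (hU : Module.finrank F2 U = k) :
    ∑ u : U, f u = 0 := by
  classical
  let e := (Module.finBasisOfFinrankEq F2 U hU).equivFun.symm
  obtain ⟨p, hp, hpd⟩ := exists_eval_eq_comp_linear f (U.subtype ∘ₗ e.toLinearMap)
  have h0 := MvPolynomial.sum_eval_eq_zero p (by simpa [ZMod.card] using hpd.trans_lt hf)
  rw [← h0, ← Equiv.sum_comp e.toEquiv]
  refine Finset.sum_congr rfl fun x _ => ?_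
  simp [hp]

/-! ### XOR-AND-XOR circuits -/

/-- An XOR gate computes every affine form: the constant `1` is the XOR of `x₀` and `¬x₀`. -/
theorem exists_literals_sum_eq {n : ℕ} (hn : 0 < n) (a : Fin n → F2) (b : F2) :
    ∃ S : Finset (Literal n), ∀ x, ∑ l ∈ S, Literal.eval l x = dotProduct a x + b := by
  classical
  let i₀ : Fin n := ⟨0, hn⟩
  let e : Fin n → F2 := Pi.single i₀ b
  let w (l : Literal n) : F2 := if l.2 then e l.1 else a l.1 + e l.1
  refine ⟨Finset.univ.filter fun l => w l = 1, fun x => ?_⟩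
  have h01 (t z : F2) : (if t = 1 then z else 0) = t * z := by
    revert t z; decide
  have h2 (t : F2) : t + t = 0 := CharTwo.add_self_eq_zero t
  rw [Finset.sum_filter, Finset.sum_congr rfl fun l _ => h01 (w l) _, Fintype.sum_prod_type]
  have hterm (i : Fin n) : ∑ s : Bool, w (i, s) * Literal.eval (i, s) x = a i * x i + e i := by
    simp only [Fintype.sum_bool, w, Literal.eval, if_true, Bool.false_eq_true, if_false]
    linear_combination h2 (e i * x i)
  rw [Finset.sum_congr rfl fun i _ => hterm i, Finset.sum_add_distrib]
  simp [dotProduct, e]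

/-- A circuit whose XOR and AND gates are indexed by arbitrary finite types. -/
theorem exists_xaxCircuit {n : ℕ} {α β : Type*} [Fintype α] [Fintype β]
    (xorIn : α → Finset (Literal n)) (andIn : β → Finset α) (topIn : Finset β) :
    ∃ D : XAXCircuit n, D.size = Fintype.card α + Fintype.card β + 1 ∧
      ∀ x, D.eval x = ∑ j ∈ topIn, ∏ g ∈ andIn j, ∑ l ∈ xorIn g, Literal.eval l x := by
  let eα := Fintype.equivFin α
  let eβ := Fintype.equivFin β
  refine ⟨⟨_, _, fun g => xorIn (eα.symm g), fun j => (andIn (eβ.symm j)).map eα.toEmbedding,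
    topIn.map eβ.toEmbedding⟩, rfl, fun x => ?_⟩
  simp [XAXCircuit.eval]

/-- Each `fᵢ(Aᵢ x)` is the XOR, over the points `y` with `fᵢ y = 1`, of the AND over `j` of the
affine forms `(Aᵢ x)ⱼ + yⱼ + 1`. -/
theorem exists_xaxCircuit_xorConstruction {n d m : ℕ} (hn : 0 < n)
    (A : Fin m → Matrix (Fin d) (Fin n) F2) (fs : Fin m → (Fin d → F2) → F2) :
    ∃ D : XAXCircuit n, D.Computes (xorConstruction A fs) ∧
      D.size = m * (d * 2) + m * 2 ^ d + 1 := by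
  classical
  choose S hS using fun g : Fin m × Fin d × F2 =>
    exists_literals_sum_eq hn (A g.1 g.2.1) (g.2.2 + 1)
  obtain ⟨D, hD, hDe⟩ := exists_xaxCircuit S
    (fun p : Fin m × (Fin d → F2) => Finset.univ.image fun j => (p.1, j, p.2 j))
    (Finset.univ.filter fun p => fs p.1 p.2 = 1)
  refine ⟨D, fun x => ?_, by simpa [ZMod.card] using hD⟩
  have h01 (t z : F2) : (if t = 1 then z else 0) = t * z := by
    revert t z; decide
  have hind (i : Fin m) (y : Fin d → F2) :
      ∏ g ∈ Finset.univ.image (fun j => (i, j, y j)), ∑ l ∈ S g, Literal.eval l x =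
        if y = (A i).mulVec x then 1 else 0 := by
    rw [Finset.prod_image (by intro j _ j' _ h; simpa using (Prod.mk.inj (Prod.mk.inj h).2).1)]
    simp only [hS]
    have hb (s t : F2) : s + (t + 1) = if t = s then 1 else 0 := by revert s t; decide
    split_ifs with h
    · refine Finset.prod_eq_one fun j _ => ?_
      exact (hb _ _).trans (if_pos (congrFun h j))
    · obtain ⟨j, hj⟩ := Function.ne_iff.1 h
      refine Finset.prod_eq_zero (Finset.mem_univ j) ?_
      exact (hb _ _).trans (if_neg hj)
  rw [hDe, Finset.sum_filter, Fintype.sum_prod_type]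
  refine Finset.sum_congr rfl fun i _ => ?_
  simp only [h01, hind]
  simp

/-! ### De Morgan formulas -/

/-- The function `f` has a De Morgan formula with at most `s` leaves; a formula has one leaf more
than gates. -/
def HasFormula {n : ℕ} (f : (Fin n → F2) → F2) (s : ℕ) : Prop :=
  ∃ φ : DeMorganFormula n, φ.Computes f ∧ φ.size + 1 ≤ s

/-- De Morgan's laws: exchange AND with OR, and complement the leaves. -/
def DeMorganFormula.dual {n : ℕ} : DeMorganFormula n → DeMorganFormula n
  | .pos i => .neg i
  | .neg i => .pos i
  | .and φ ψ => .or φ.dual ψ.dual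
  | .or φ ψ => .and φ.dual ψ.dual

theorem DeMorganFormula.size_dual {n : ℕ} (φ : DeMorganFormula n) : φ.dual.size = φ.size := by
  induction φ <;> simp_all [dual, size]

theorem DeMorganFormula.eval_dual {n : ℕ} (φ : DeMorganFormula n) (x : Fin n → Bool) :
    φ.dual.eval x = !φ.eval x := by
  induction φ <;> simp_all [dual, eval]

namespace HasFormula

variable {n : ℕ} {f g h : (Fin n → F2) → F2} {r s t : ℕ}

theorem mono (hf : HasFormula f s) (hst : s ≤ t) : HasFormula f t :=
  let ⟨φ, h, hs⟩ := hf
  ⟨φ, h, hs.trans hst⟩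

theorem add_one (hf : HasFormula f s) : HasFormula (f + 1) s := by
  obtain ⟨φ, h, hs⟩ := hf
  refine ⟨φ.dual, fun x => ?_, by rwa [DeMorganFormula.size_dual]⟩
  rw [DeMorganFormula.eval_dual, h x]
  have hb (a : F2) : (!decide (a = 1)) = decide (a + 1 = 1) := by revert a; decide
  exact hb (f x)

theorem mul (hf : HasFormula f s) (hg : HasFormula g t) : HasFormula (f * g) (s + t) := by
  obtain ⟨φ, h, hs⟩ := hf
  obtain ⟨ψ, h', ht⟩ := hg
  refine ⟨.and φ ψ, fun x => ?_, by simp only [DeMorganFormula.size]; omega⟩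
  have hb (a b : F2) : (decide (a = 1) && decide (b = 1)) = decide (a * b = 1) := by
    revert a b; decide
  rw [DeMorganFormula.eval, h x, h' x]
  exact hb (f x) (g x)

/-- Selecting between `f` and `g` according to `h`. -/
theorem mux (hh : HasFormula h r) (hf : HasFormula f s) (hg : HasFormula g t) :
    HasFormula (h * f + (h + 1) * g) (2 * r + s + t) := by
  obtain ⟨φ, h₁, hs⟩ := hh.mul hf
  obtain ⟨ψ, h₂, ht⟩ := hh.add_one.mul hg
  refine ⟨.or φ ψ, fun x => ?_, by simp only [DeMorganFormula.size]; omega⟩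
  have hb (a b c : F2) : (decide (a * b = 1) || decide ((a + 1) * c = 1)) =
      decide (a * b + (a + 1) * c = 1) := by
    revert a b c; decide
  rw [DeMorganFormula.eval, h₁ x, h₂ x]
  exact hb (h x) (f x) (g x)

theorem add (hf : HasFormula f s) (hg : HasFormula g t) : HasFormula (f + g) (2 * s + 2 * t) := by
  have h2 : g + g = 0 := funext fun x => CharTwo.add_self_eq_zero (g x)
  have : f + g = f * (g + 1) + (f + 1) * g := by
    linear_combination -(f * h2)
  rw [this]
  exact (hf.mux hg.add_one hg).mono (by omega)

theorem coord (i : Fin n) : HasFormula (fun x => x i) 1 :=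
  ⟨.pos i, fun _ => rfl, le_rfl⟩

theorem zero (hn : 0 < n) : HasFormula (0 : (Fin n → F2) → F2) 2 := by
  have h := (coord ⟨0, hn⟩).mul (coord ⟨0, hn⟩).add_one
  have hb (a : F2) : a * (a + 1) = 0 := by revert a; decide
  convert h using 1
  exact funext fun x => (hb _).symm

theorem const (hn : 0 < n) (b : F2) : HasFormula (fun _ : Fin n → F2 => b) 2 := by
  fin_cases b
  · exact zero hn
  · have h := (zero hn).add_one
    rw [zero_add] at h
    exact h

/-- Splitting a sum in halves doubles the leaves for each half, hence quadruples the bound. -/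
theorem sum_of_card_le_two_pow {ι : Type*} (hn : 0 < n) {F : ι → (Fin n → F2) → F2} (hs : 2 ≤ s)
    (t : ℕ) (S : Finset ι) (hS : S.card ≤ 2 ^ t) (hF : ∀ i ∈ S, HasFormula (F i) s) :
    HasFormula (∑ i ∈ S, F i) (4 ^ t * s) := by
  classical
  induction t generalizing S with
  | zero =>
    rcases Nat.le_one_iff_eq_zero_or_eq_one.1 hS with h | h
    · rw [Finset.card_eq_zero.1 h, Finset.sum_empty]
      exact (zero hn).mono (by omega)
    · obtain ⟨i, rfl⟩ := Finset.card_eq_one.1 h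
      simpa using hF i (Finset.mem_singleton_self i)
  | succ t ih =>
    rcases le_or_gt S.card (2 ^ t) with h | h
    · exact (ih S h hF).mono (Nat.mul_le_mul_right _ (Nat.pow_le_pow_right (by norm_num) t.le_succ))
    · obtain ⟨T, hTS, hT⟩ := Finset.exists_subset_card_eq h.le
      have h₁ := ih T hT.le fun i hi => hF i (hTS hi)
      have h₂ := ih (S \ T) (by rw [Finset.card_sdiff_of_subset hTS, hT]; omega)
        fun i hi => hF i (Finset.sdiff_subset hi)
      rw [← Finset.sum_sdiff hTS]
      exact (h₂.add h₁).mono (by rw [pow_succ]; linarith)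

theorem sum {m : ℕ} (hn : 0 < n) (hm : 0 < m) {F : Fin m → (Fin n → F2) → F2} (hs : 2 ≤ s)
    (hF : ∀ i, HasFormula (F i) s) : HasFormula (∑ i, F i) (4 * m ^ 2 * s) := by
  have hclog : 2 ^ Nat.clog 2 m ≤ 2 * m := by
    rcases Nat.lt_or_ge 1 m with h | h
    · have h1 := Nat.pow_pred_clog_lt_self (b := 2) (by norm_num) h
      have h2 : 0 < Nat.clog 2 m := Nat.clog_pos (by norm_num) h
      obtain ⟨c, hc⟩ := Nat.exists_eq_succ_of_ne_zero h2.ne'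
      rw [hc] at h1 ⊢
      rw [pow_succ]
      simp only [Nat.pred_succ] at h1
      omega
    · have : m = 1 := le_antisymm h hm
      simp [this]
  refine (sum_of_card_le_two_pow hn hs (Nat.clog 2 m) Finset.univ
    (by simpa using Nat.le_pow_clog (b := 2) (by norm_num) m) fun i _ => hF i).mono
      (Nat.mul_le_mul_right _ ?_)
  calc 4 ^ Nat.clog 2 m = (2 ^ Nat.clog 2 m) ^ 2 := by
        rw [← pow_mul, mul_comm, pow_mul]; norm_num
    _ ≤ (2 * m) ^ 2 := Nat.pow_le_pow_left hclog 2
    _ = 4 * m ^ 2 := by ring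

/-- A decision tree that queries the coordinates one after the other. -/
theorem comp {d : ℕ} (hn : 0 < n) (h : (Fin d → F2) → F2) {y : Fin d → (Fin n → F2) → F2}
    (hy : ∀ j, HasFormula (y j) r) :
    HasFormula (fun x => h fun j => y j x) (2 ^ d * (2 * r + 2)) := by
  suffices HasFormula (fun x => h fun j => y j x) (2 ^ d * (2 * r + 2) - 2 * r) from
    this.mono (Nat.sub_le _ _)
  induction d with
  | zero =>
    have : (fun x => h fun j => y j x) = fun _ => h Fin.elim0 := by
      funext x; congr 1; exact Subsingleton.elim _ _
    rw [this]
    exact (const hn _).mono (by simp)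
  | succ d ih =>
    have ih' (b : F2) := ih (fun z => h (Fin.cons b z)) fun j => hy j.succ
    have hb (b : F2) : b = 0 ∨ b = 1 := by revert b; decide
    convert ((hy 0).mux (ih' 1) (ih' 0)).mono (t := 2 ^ (d + 1) * (2 * r + 2) - 2 * r) ?_ using 1
    · funext x
      have hcons : (fun j => y j x) = Fin.cons (y 0 x) fun j : Fin d => y j.succ x :=
        (Fin.cons_self_tail _).symm
      rw [hcons]
      rcases hb (y 0 x) with h0 | h0
      · simp [h0]
      · simp [h0, CharTwo.add_self_eq_zero]
    · have : 2 * r ≤ 2 ^ d * (2 * r + 2) := by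
        nlinarith [Nat.one_le_two_pow (n := d)]
      rw [pow_succ, mul_right_comm]
      omega

theorem dotProduct (hn : 0 < n) (a : Fin n → F2) :
    HasFormula (fun x => _root_.dotProduct a x) (8 * n ^ 2) := by
  have hb (b : F2) : b = 0 ∨ b = 1 := by revert b; decide
  have := sum (s := 2) hn hn (F := fun i x => a i * x i) le_rfl fun i => by
    rcases hb (a i) with h | h
    · simpa [h, Pi.zero_def] using zero hn
    · simpa [h] using (coord i).mono one_le_two
  convert this.mono (t := 8 * n ^ 2) (by linarith) using 1
  funext x
  simp [_root_.dotProduct]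

end HasFormula

theorem exists_formula_xorConstruction {n d m : ℕ} (hn : 0 < n) (hm : 0 < m)
    (A : Fin m → Matrix (Fin d) (Fin n) F2) (fs : Fin m → (Fin d → F2) → F2) :
    ∃ φ : DeMorganFormula n, φ.Computes (xorConstruction A fs) ∧
      φ.size ≤ 72 * m ^ 2 * n ^ 2 * 2 ^ d := by
  have hterm (i) : HasFormula (fun x => fs i ((A i).mulVec x)) (2 ^ d * (2 * (8 * n ^ 2) + 2)) :=
    HasFormula.comp hn (fs i) fun j => HasFormula.dotProduct hn (A i j)
  obtain ⟨φ, h, hs⟩ := HasFormula.sum hn hm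
    (by nlinarith [Nat.one_le_two_pow (n := d), Nat.zero_le (8 * n ^ 2)]) hterm
  refine ⟨φ, ?_, ?_⟩
  · convert h using 1
    funext x
    simp [xorConstruction]
  · have : 2 * (8 * n ^ 2) + 2 ≤ 18 * n ^ 2 := by nlinarith
    calc φ.size ≤ 4 * m ^ 2 * (2 ^ d * (2 * (8 * n ^ 2) + 2)) := by omega
      _ ≤ 4 * m ^ 2 * (2 ^ d * (18 * n ^ 2)) := by gcongr
      _ = _ := by ring

/-! ### Bias of a random member of the construction -/

theorem abs_sum_bitSign_le_one (T : Finset F2) : |∑ b ∈ T, bitSign b| ≤ 1 := by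
  have hT : T = ∅ ∨ T = {0} ∨ T = {1} ∨ T = {0, 1} := by revert T; decide
  rcases hT with rfl | rfl | rfl | rfl <;> simp [bitSign]

/-- The distance of a bit from uniform is half of the absolute value of its mean sign. -/
theorem statDist_outputDist_le {n : ℕ} {f : (Fin n → F2) → F2} {u₀ : Fin n → F2}
    {U : Submodule F2 (Fin n → F2)} [Fintype U] {ε : ℝ}
    (h : |∑ u : U, bitSign (f (u₀ + u))| ≤ 2 * ε * Fintype.card U) :
    statDist (outputDist f (affineCoset u₀ U)) uniformF2 ≤ ε := by
  classical
  set X := ∑ u : U, bitSign (f (u₀ + u))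
  have hN : (0 : ℝ) < Fintype.card U := by exact_mod_cast Fintype.card_pos
  have hinj : Function.Injective fun u : Fin n → F2 => u₀ + u := add_right_injective u₀
  have hS : (affineCoset u₀ U).ncard = Fintype.card U := by
    rw [affineCoset, Set.ncard_image_of_injective _ hinj, ← Nat.card_eq_fintype_card]
    rfl
  have hfib (b : F2) : {x ∈ affineCoset u₀ U | f x = b}.ncard =
      (Finset.univ.filter fun u : U => f (u₀ + u) = b).card := by
    rw [← Set.ncard_coe_finset, ← Set.ncard_image_of_injective
      (f := fun u : U => u₀ + (u : Fin n → F2)) _ (hinj.comp Subtype.val_injective)]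
    congr 1
    ext x
    simp only [affineCoset, Set.mem_image, SetLike.mem_coe, Set.mem_ofPred_eq, Finset.coe_filter,
      Finset.mem_univ, true_and, Subtype.exists]
    constructor
    · rintro ⟨⟨u, hu, rfl⟩, hb⟩
      exact ⟨u, hu, hb, rfl⟩
    · rintro ⟨u, hu, hb, rfl⟩
      exact ⟨⟨u, hu, rfl⟩, hb⟩
  have hpt (b : F2) : outputDist f (affineCoset u₀ U) b - uniformF2 b =
      bitSign b * (X / (2 * Fintype.card U)) := by
    have hind (a b : F2) : (if a = b then (1 : ℝ) else 0) = (1 + bitSign b * bitSign a) / 2 := by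
      have h01 (t : F2) : t = 0 ∨ t = 1 := by revert t; decide
      rcases h01 a with rfl | rfl <;> rcases h01 b with rfl | rfl <;> norm_num [bitSign]
    have hcount : ((Finset.univ.filter fun u : U => f (u₀ + u) = b).card : ℝ) =
        (Fintype.card U + bitSign b * X) / 2 := by
      rw [Finset.card_filter, Nat.cast_sum]
      simp only [Nat.cast_ite, Nat.cast_one, Nat.cast_zero, hind]
      rw [← Finset.sum_div, Finset.sum_add_distrib, ← Finset.mul_sum]
      simp [X]
    rw [outputDist, hS, hfib, hcount, uniformF2, ZMod.card]
    field_simp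
    push_cast
    ring
  refine ciSup_le fun T => ?_
  rw [← Finset.sum_sub_distrib, Finset.sum_congr rfl fun b _ => hpt b, ← Finset.sum_mul, abs_mul]
  calc _ ≤ 1 * |X / (2 * Fintype.card U)| := by
        gcongr
        exact abs_sum_bitSign_le_one T
    _ = |X| / (2 * Fintype.card U) := by rw [one_mul, abs_div, abs_of_pos (mul_pos two_pos hN)]
    _ ≤ ε := by
        rw [div_le_iff₀ (by positivity)]
        linarith

section Restriction

variable {n d m : ℕ} (A : Fin m → Matrix (Fin d) (Fin n) F2)

/-- The restriction of `xorConstruction A fs` to the coset `u₀ + U`, as an additive function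
of `fs`. -/
def restrictionHom (u₀ : Fin n → F2) (U : Submodule F2 (Fin n → F2)) :
    (Fin m → (Fin d → F2) → F2) →+ (U → F2) where
  toFun fs u := xorConstruction A fs (u₀ + u)
  map_zero' := by ext; simp [xorConstruction]
  map_add' fs gs := by ext; simp [xorConstruction, Finset.sum_add_distrib]

/-- If some `Aᵢ` is injective on `U`, then `fᵢ` alone produces every function on `u₀ + U`; hence a
uniform choice of `fs` restricts to a uniformly random function there. -/
theorem restrictionHom_surjective (u₀ : Fin n → F2) {U : Submodule F2 (Fin n → F2)} {i : Fin m}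
    (hi : LinearMap.ker (A i).mulVecLin ⊓ U = ⊥) :
    Function.Surjective (restrictionHom A u₀ U) := by
  classical
  intro g
  let e (u : U) : Fin d → F2 := (A i).mulVec (u₀ + u)
  have he : Function.Injective e := by
    intro u v huv
    have hker : (A i).mulVec ((u : Fin n → F2) - v) = 0 := by
      simp only [e, Matrix.mulVec_add] at huv
      rw [Matrix.mulVec_sub, add_left_cancel huv, sub_self]
    have hmem : (u : Fin n → F2) - v ∈ LinearMap.ker (A i).mulVecLin ⊓ U :=
      ⟨by simpa using hker, U.sub_mem u.2 v.2⟩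
    rw [hi, Submodule.mem_bot, sub_eq_zero] at hmem
    exact Subtype.ext hmem
  refine ⟨Pi.single i (Function.extend e g 0), ?_⟩
  ext u
  change ∑ j, (Pi.single i (Function.extend e g 0) : Fin m → (Fin d → F2) → F2) j
    ((A j).mulVec (u₀ + u)) = g u
  rw [Finset.sum_eq_single i (fun j _ hj => by simp [hj]) (by simp), Pi.single_eq_same]
  exact he.extend_apply g 0 u

/-- The functions `fs` for which the construction is too biased on `u₀ + U` are rare. -/
theorem card_biased_le {u₀ : Fin n → F2} {U : Submodule F2 (Fin n → F2)} [Fintype U] {i : Fin m}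
    (hi : LinearMap.ker (A i).mulVecLin ⊓ U = ⊥) {ε : ℝ} (hε : 0 ≤ ε)
    [DecidablePred fun fs : Fin m → (Fin d → F2) → F2 =>
      2 * ε * Fintype.card U < |∑ u : U, bitSign (xorConstruction A fs (u₀ + u))|] :
    ((Finset.univ.filter fun fs : Fin m → (Fin d → F2) → F2 => 2 * ε * Fintype.card U <
        |∑ u : U, bitSign (xorConstruction A fs (u₀ + u))|).card : ℝ) ≤
      2 * Real.exp (-(2 * ε ^ 2 * Fintype.card U)) *
        Fintype.card (Fin m → (Fin d → F2) → F2) := by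
  classical
  have h := card_filter_comp_mul_card _ (restrictionHom_surjective A u₀ hi)
    fun g => 2 * ε * Fintype.card U < |∑ u : U, bitSign (g u)|
  have hH : ((Fintype.card (U → F2) : ℕ) : ℝ) = 2 ^ Fintype.card U := by simp [ZMod.card]
  have hset : (Finset.univ.filter fun fs : Fin m → (Fin d → F2) → F2 => 2 * ε * Fintype.card U <
      |∑ u : U, bitSign (xorConstruction A fs (u₀ + u))|) = Finset.univ.filter fun fs =>
        2 * ε * Fintype.card U < |∑ u : U, bitSign (restrictionHom A u₀ U fs u)| := by
    ext fs
    rw [Finset.mem_filter, Finset.mem_filter]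
    rfl
  have h' := congrArg (Nat.cast : ℕ → ℝ) h
  rw [Nat.cast_mul, Nat.cast_mul, hH] at h'
  have h2 : (0 : ℝ) < 2 ^ Fintype.card U := by positivity
  rw [hset]
  refine le_of_mul_le_mul_right ?_ h2
  have hb := mul_le_mul_of_nonneg_right (card_sum_bitSign_gt_le (ι := U) hε)
    (Nat.cast_nonneg (α := ℝ) (Fintype.card (Fin m → (Fin d → F2) → F2)))
  rw [h']
  exact hb.trans_eq (by ring)

/-- For half of all `fs` the sum over `U` vanishes. -/
theorem two_mul_card_sum_eq_zero {U : Submodule F2 (Fin n → F2)} [Fintype U] {i : Fin m}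
    (hi : LinearMap.ker (A i).mulVecLin ⊓ U = ⊥) :
    2 * (Finset.univ.filter fun fs : Fin m → (Fin d → F2) → F2 =>
      ∑ u : U, xorConstruction A fs u = 0).card = Fintype.card (Fin m → (Fin d → F2) → F2) := by
  classical
  let σ : (U → F2) →+ F2 :=
    { toFun := fun g => ∑ u, g u
      map_zero' := by simp
      map_add' := fun g g' => by simp [Finset.sum_add_distrib] }
  have hσ : Function.Surjective σ := fun b => ⟨Pi.single 0 b, by simp [σ]⟩
  have h := card_filter_comp_mul_card (σ.comp (restrictionHom A 0 U))
    (hσ.comp (restrictionHom_surjective A 0 hi)) fun b => b = 0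
  simp only [Finset.filter_eq', Finset.mem_univ, if_true, Finset.card_singleton, one_mul,
    ZMod.card] at h
  rw [mul_comm, ← h]
  simp [σ, restrictionHom]

end Restriction

/-- If the failure probability of the union bound over all cosets is below `1 / 2`, then some
choice of `fs` gives an extractor whose degree is at least `k`. -/
theorem exists_isAffineExtractor_le_funDegree {n k d m : ℕ} (hkn : k ≤ n) {ε : ℝ} (hε : 0 ≤ ε)
    (A : Fin m → Matrix (Fin d) (Fin n) F2) (hA : IsLinearInjector k A)
    (hsmall : 2 ^ (n * (k + 1)) * (2 * Real.exp (-(2 * ε ^ 2 * 2 ^ k))) < 1 / 2) :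
    ∃ fs : Fin m → (Fin d → F2) → F2, IsAffineExtractor (xorConstruction A fs) k ε ∧
      k ≤ funDegree (xorConstruction A fs) := by
  classical
  have hcard {U : Submodule F2 (Fin n → F2)} (hU : Module.finrank F2 U = k) :
      Fintype.card U = 2 ^ k := by
    rw [Module.card_eq_pow_finrank (K := F2), ZMod.card, hU]
  obtain ⟨U₁, hU₁⟩ : ∃ U : Submodule F2 (Fin n → F2), Module.finrank F2 U = k := by
    refine ⟨Submodule.span F2 (Set.range (Pi.basisFun F2 (Fin n) ∘ Fin.castLE hkn)), ?_⟩
    rw [finrank_span_eq_card ((Pi.basisFun F2 (Fin n)).linearIndependent.comp _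
      (Fin.castLE_injective hkn)), Fintype.card_fin]
  obtain ⟨i₁, hi₁⟩ := hA U₁ hU₁
  let Ω := Fin m → (Fin d → F2) → F2
  let W (v : Fin k → Fin n → F2) := Submodule.span F2 (Set.range v)
  let bias (p : (Fin n → F2) × (Fin k → Fin n → F2)) : Finset Ω := Finset.univ.filter fun fs =>
    Module.finrank F2 (W p.2) = k ∧
      2 * ε * Fintype.card (W p.2) < |∑ u : W p.2, bitSign (xorConstruction A fs (p.1 + u))|
  let low : Finset Ω := Finset.univ.filter fun fs => ∑ u : U₁, xorConstruction A fs u = 0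
  have hbias (p) : ((bias p).card : ℝ) ≤
      2 * Real.exp (-(2 * ε ^ 2 * 2 ^ k)) * Fintype.card Ω := by
    by_cases hp : Module.finrank F2 (W p.2) = k
    · obtain ⟨i, hi⟩ := hA _ hp
      have h := card_biased_le A (u₀ := p.1) hi hε
      simp only [bias, hp, true_and]
      rw [hcard hp] at h ⊢
      exact_mod_cast h
    · simp only [bias, hp, false_and, Finset.filter_false, Finset.card_empty, Nat.cast_zero]
      positivity
  have hΩ : (0 : ℝ) < Fintype.card Ω := by exact_mod_cast Fintype.card_pos
  have hlow : 2 * (low.card : ℝ) = Fintype.card Ω := by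
    exact_mod_cast two_mul_card_sum_eq_zero A hi₁
  have hlt : (low ∪ Finset.univ.biUnion bias).card < Fintype.card Ω := by
    have hsum : ((Finset.univ.biUnion bias).card : ℝ) ≤
        2 ^ (n * (k + 1)) * (2 * Real.exp (-(2 * ε ^ 2 * 2 ^ k)) * Fintype.card Ω) := by
      calc ((Finset.univ.biUnion bias).card : ℝ) ≤ ∑ p, ((bias p).card : ℝ) := by
            exact_mod_cast Finset.card_biUnion_le
        _ ≤ ∑ _p : (Fin n → F2) × (Fin k → Fin n → F2),
            2 * Real.exp (-(2 * ε ^ 2 * 2 ^ k)) * (Fintype.card Ω : ℝ) :=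
          Finset.sum_le_sum fun p _ => hbias p
        _ = _ := by
          rw [Finset.sum_const, nsmul_eq_mul, Finset.card_univ]
          congr 1
          simp only [Fintype.card_prod, Fintype.card_fun, Fintype.card_fin, ZMod.card]
          push_cast
          ring
    have hun : ((low ∪ Finset.univ.biUnion bias).card : ℝ) ≤
        low.card + (Finset.univ.biUnion bias).card := by
      exact_mod_cast Finset.card_union_le _ _
    have := mul_lt_mul_of_pos_right hsmall hΩ
    rw [← Nat.cast_lt (α := ℝ)]
    nlinarith
  obtain ⟨fs, hfs⟩ : ∃ fs, fs ∉ low ∪ Finset.univ.biUnion bias := by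
    by_contra! h
    exact hlt.ne ((Finset.card_eq_iff_eq_univ _).2 (Finset.eq_univ_iff_forall.2 h))
  simp only [Finset.mem_union, not_or, Finset.mem_biUnion, Finset.mem_univ, true_and,
    not_exists] at hfs
  refine ⟨fs, fun u₀ U hU => ?_, ?_⟩
  · obtain ⟨v, rfl⟩ := exists_tuple_span_eq hU
    refine statDist_outputDist_le (le_of_not_gt fun h => hfs.2 (u₀, v) ?_)
    simp only [bias, Finset.mem_filter, Finset.mem_univ, true_and]
    exact ⟨hU, h⟩
  · by_contra! h
    exact hfs.1 (Finset.mem_filter.2 ⟨Finset.mem_univ _, sum_submodule_eq_zero h U₁ hU₁⟩)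

/-! ### The parameters -/

section Parameters

variable {n k : ℕ} {ε : ℝ}

theorem le_div_sq (hε : 0 < ε) (hε1 : ε ≤ 1) : (n : ℝ) ≤ n / ε ^ 2 :=
  le_div_self n.cast_nonneg (by positivity) (pow_le_one₀ hε.le hε1)

theorem one_le_logb_div_sq (hn : 2 ≤ n) (hε : 0 < ε) (hε1 : ε ≤ 1) :
    1 ≤ Real.logb 2 (n / ε ^ 2) := by
  have h2 : (2 : ℝ) ≤ n := by exact_mod_cast hn
  have h := h2.trans (le_div_sq hε hε1)
  rw [Real.le_logb_iff_rpow_le one_lt_two (by linarith), Real.rpow_one]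
  exact h

theorem logb_le_self {x : ℝ} (hx : 0 < x) : Real.logb 2 x ≤ x := by
  rw [Real.logb_le_iff_le_rpow one_lt_two hx]
  have h := one_add_mul_self_le_rpow_one_add (s := 1) (by norm_num) (p := x)
  rcases le_or_gt 1 x with h1 | h1
  · have := h h1
    norm_num at this
    linarith
  · exact h1.le.trans (Real.one_le_rpow one_le_two hx.le)

theorem logb_div_sq_le (hn : 2 ≤ n) (hε : 0 < ε) :
    Real.logb 2 (n / ε ^ 2) ≤ 2 * Real.logb 2 (n / ε) := by
  have h2 : (2 : ℝ) ≤ n := by exact_mod_cast hn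
  have hpow : 2 * Real.logb 2 (n / ε) = Real.logb 2 ((n / ε) ^ 2) := by
    rw [Real.logb_pow]
    norm_num
  rw [hpow]
  refine Real.logb_le_logb_of_le one_lt_two (by positivity) ?_
  rw [div_pow]
  gcongr
  nlinarith

theorem two_rpow_dimBound (hn : 2 ≤ n) (hε : 0 < ε) (hε1 : ε ≤ 1) :
    (2 : ℝ) ^ dimBound n ε = n / ε ^ 2 * Real.logb 2 (n / ε ^ 2) := by
  have h2 : (0 : ℝ) < n := by exact_mod_cast (by omega : 0 < n)
  have h := one_le_logb_div_sq hn hε hε1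
  rw [dimBound, Real.rpow_add two_pos,
    Real.rpow_logb two_pos (by norm_num) (by positivity),
    Real.rpow_logb two_pos (by norm_num) (by linarith)]

theorem one_le_dimBound (hn : 2 ≤ n) (hε : 0 < ε) (hε1 : ε ≤ 1) : 1 ≤ dimBound n ε := by
  have h := one_le_logb_div_sq hn hε hε1
  have := Real.logb_nonneg one_lt_two h
  rw [dimBound]
  linarith

theorem natCast_le_of_le_dimBound (hn : 2 ≤ n) (hε : 0 < ε) (hε1 : ε ≤ 1)
    (hk : (k : ℝ) ≤ dimBound n ε + 4) :
    (k : ℝ) ≤ 2 * Real.logb 2 (n / ε ^ 2) + 4 := by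
  have h := one_le_logb_div_sq hn hε hε1
  have := logb_le_self (x := Real.logb 2 (n / ε ^ 2)) (by linarith)
  rw [dimBound] at hk
  linarith

theorem two_pow_le_of_le_dimBound (hn : 2 ≤ n) (hε : 0 < ε) (hε1 : ε ≤ 1)
    (hk : (k : ℝ) ≤ dimBound n ε + 4) :
    (2 : ℝ) ^ k ≤ 16 * (n / ε ^ 2 * Real.logb 2 (n / ε ^ 2)) := by
  rw [← two_rpow_dimBound hn hε hε1, ← Real.rpow_natCast]
  refine (Real.rpow_le_rpow_of_exponent_le one_le_two hk).trans_eq ?_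
  rw [Real.rpow_add two_pos, mul_comm]
  norm_num

theorem le_two_pow_of_dimBound_le (hn : 2 ≤ n) (hε : 0 < ε) (hε1 : ε ≤ 1)
    (hk : dimBound n ε + 3 ≤ k) :
    8 * (n / ε ^ 2 * Real.logb 2 (n / ε ^ 2)) ≤ (2 : ℝ) ^ k := by
  rw [← two_rpow_dimBound hn hε hε1, ← Real.rpow_natCast]
  refine le_trans (le_of_eq ?_) (Real.rpow_le_rpow_of_exponent_le one_le_two hk)
  rw [Real.rpow_add two_pos, mul_comm]
  norm_num

/-- The union bound over the at most `2 ^ (n * (k + 1))` cosets closes because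
`ε² 2ᵏ ≥ 8 n log (n / ε²)` while `k + 1 ≤ 2 log (n / ε²) + 5`. -/
theorem union_bound_lt_half (hn : 2 ≤ n) (hε : 0 < ε) (hε1 : ε ≤ 1)
    (hk : dimBound n ε + 3 ≤ k) (hk' : (k : ℝ) ≤ dimBound n ε + 4) :
    2 ^ (n * (k + 1)) * (2 * Real.exp (-(2 * ε ^ 2 * 2 ^ k))) < 1 / 2 := by
  have h2 : (2 : ℝ) ≤ n := by exact_mod_cast hn
  have hl := one_le_logb_div_sq hn hε hε1
  have hkl := natCast_le_of_le_dimBound hn hε hε1 hk'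
  have hp := le_two_pow_of_dimBound_le hn hε hε1 hk
  set l := Real.logb 2 (n / ε ^ 2)
  have hx : 16 * (n * l) ≤ 2 * ε ^ 2 * 2 ^ k := by
    calc 16 * (n * l) = 2 * ε ^ 2 * (8 * (n / ε ^ 2 * l)) := by field_simp; norm_num
      _ ≤ _ := by gcongr
  have hM : ((n * (k + 1) + 2 : ℕ) : ℝ) ≤ 2 * ε ^ 2 * 2 ^ k := by
    push_cast
    have h1 := mul_le_mul_of_nonneg_left hkl (by linarith : (0 : ℝ) ≤ n)
    have h3 := mul_le_mul_of_nonneg_left hl (by linarith : (0 : ℝ) ≤ n)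
    linarith
  have hexp : (2 : ℝ) ^ (n * (k + 1) + 2) < Real.exp (2 * ε ^ 2 * 2 ^ k) := by
    refine lt_of_lt_of_le ?_ (Real.exp_le_exp.2 hM)
    rw [← mul_one ((n * (k + 1) + 2 : ℕ) : ℝ), Real.exp_nat_mul]
    exact pow_lt_pow_left₀ (by linarith [Real.exp_one_gt_d9]) two_pos.le (by omega)
  rw [Real.exp_neg, ← div_eq_mul_inv, ← mul_div_assoc, div_lt_iff₀ (Real.exp_pos _)]
  rw [pow_add] at hexp
  linarith

theorem circuit_size_le (hn : 2 ≤ n) (hε : 0 < ε) (hε1 : ε ≤ 1)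
    (hk : (k : ℝ) ≤ dimBound n ε + 4) :
    6 * n * k * (2 : ℝ) ^ k ≤ 2304 * ((n / ε) ^ 2 * Real.logb 2 (n / ε) ^ 3) := by
  have hl := one_le_logb_div_sq hn hε hε1
  have hkl := natCast_le_of_le_dimBound hn hε hε1 hk
  have hp := two_pow_le_of_le_dimBound hn hε hε1 hk
  have hlm := logb_div_sq_le hn hε
  have hm : (1 : ℝ) ≤ Real.logb 2 (n / ε) := by
    have h2 : (2 : ℝ) ≤ n := by exact_mod_cast hn
    rw [Real.le_logb_iff_rpow_le one_lt_two (by positivity), Real.rpow_one]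
    exact h2.trans (le_div_self (by linarith) hε hε1)
  set l := Real.logb 2 (n / ε ^ 2)
  set t := Real.logb 2 (n / ε)
  calc 6 * n * k * (2 : ℝ) ^ k ≤ 6 * n * (6 * l) * (16 * (n / ε ^ 2 * l)) := by
        gcongr
        linarith
    _ = 576 * ((n / ε) ^ 2 * l ^ 2) := by field_simp; norm_num
    _ ≤ 576 * ((n / ε) ^ 2 * (2 * t) ^ 2) := by gcongr
    _ = 2304 * ((n / ε) ^ 2 * t ^ 2) := by ring
    _ ≤ _ := by
        gcongr
        · norm_num

theorem formula_size_le (hn : 2 ≤ n) (hε : 0 < ε) (hε1 : ε ≤ 1)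
    (hk : (k : ℝ) ≤ dimBound n ε + 4) :
    144 * (n : ℝ) ^ 4 * k ^ 2 * 2 ^ k ≤
      663552 * ((n : ℝ) ^ 5 / ε ^ 2 * Real.logb 2 (n / ε) ^ 3) := by
  have hl := one_le_logb_div_sq hn hε hε1
  have hkl := natCast_le_of_le_dimBound hn hε hε1 hk
  have hp := two_pow_le_of_le_dimBound hn hε hε1 hk
  have hlm := logb_div_sq_le hn hε
  set l := Real.logb 2 (n / ε ^ 2)
  set t := Real.logb 2 (n / ε)
  calc 144 * (n : ℝ) ^ 4 * k ^ 2 * 2 ^ k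
      ≤ 144 * (n : ℝ) ^ 4 * (6 * l) ^ 2 * (16 * (n / ε ^ 2 * l)) := by
        gcongr
        linarith
    _ = 82944 * ((n : ℝ) ^ 5 / ε ^ 2 * l ^ 3) := by field_simp; norm_num
    _ ≤ 82944 * ((n : ℝ) ^ 5 / ε ^ 2 * (2 * t) ^ 3) := by gcongr
    _ = _ := by ring

end Parameters

/-! ### The construction -/

theorem mainTheorem12 :
    ∃ (n₀ : ℕ) (c C : ℝ), ∀ (n : ℕ) (ε : ℝ), n₀ < n → 0 < ε → ε ≤ 1 →
      ∀ k : ℕ, (k : ℤ) = ⌈dimBound n ε + c⌉ → k ≤ n →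
        (∃ A : Fin (n * k) → Matrix (Fin (k + 1)) (Fin n) F2, IsLinearInjector k A) ∧
        ∀ A : Fin (n * k) → Matrix (Fin (k + 1)) (Fin n) F2, IsLinearInjector k A →
          ∃ fs : Fin (n * k) → (Fin (k + 1) → F2) → F2,
            IsAffineExtractor (xorConstruction A fs) k ε ∧
            |(funDegree (xorConstruction A fs) : ℝ) - dimBound n ε| ≤ C ∧
            (∃ D : XAXCircuit n, D.Computes (xorConstruction A fs) ∧
              (D.size : ℝ) ≤ C * ((n / ε) ^ 2 * Real.logb 2 (n / ε) ^ 3)) ∧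
            (∃ φ : DeMorganFormula n, φ.Computes (xorConstruction A fs) ∧
              (φ.size : ℝ) ≤ C * ((n : ℝ) ^ 5 / ε ^ 2 * Real.logb 2 (n / ε) ^ 3)) := by
  -- `c = 3` is what the union bound needs; `C` is governed by the formula size.
  refine ⟨1, 3, 663552, fun n ε hn hε hε1 k hk hkn => ?_⟩
  replace hn : 2 ≤ n := hn
  have hk₁ : dimBound n ε + 3 ≤ k := by
    have h := Int.le_ceil (dimBound n ε + 3)
    rw [← hk] at h
    exact_mod_cast h
  have hk₂ : (k : ℝ) ≤ dimBound n ε + 4 := by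
    have h := Int.ceil_lt_add_one (dimBound n ε + 3)
    rw [← hk, Int.cast_natCast] at h
    linarith
  have hn0 : 0 < n := by omega
  have hk0 : 0 < k := by
    have h : (0 : ℝ) < k := by linarith [one_le_dimBound hn hε hε1]
    exact_mod_cast h
  refine ⟨exists_isLinearInjector hn0 hk0, fun A hA => ?_⟩
  obtain ⟨fs, hfs, hdeg⟩ := exists_isAffineExtractor_le_funDegree hkn hε.le A hA
    (union_bound_lt_half hn hε hε1 hk₁ hk₂)
  refine ⟨fs, hfs, ?_, ?_, ?_⟩
  · have h₁ : (k : ℝ) ≤ funDegree (xorConstruction A fs) := by exact_mod_cast hdeg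
    have h₂ : (funDegree (xorConstruction A fs) : ℝ) ≤ k + 1 := by
      exact_mod_cast funDegree_xorConstruction_le A fs
    rw [abs_le]
    constructor <;> linarith
  · obtain ⟨D, hD, hsize⟩ := exists_xaxCircuit_xorConstruction hn0 A fs
    refine ⟨D, hD, ?_⟩
    have hpow : k + 1 ≤ 2 ^ k := k.lt_two_pow_self
    have hnat : D.size ≤ 6 * n * k * 2 ^ k := by
      have hnk : 1 ≤ n * k := Nat.mul_pos hn0 hk0
      have h₁ : n * k * (k + 1) ≤ n * k * 2 ^ k := Nat.mul_le_mul_left _ hpow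
      have h₂ : 1 ≤ n * k * 2 ^ k := Nat.mul_pos hnk (by positivity)
      rw [hsize, pow_succ]
      linarith
    have hreal : (D.size : ℝ) ≤ 6 * n * k * 2 ^ k := by exact_mod_cast hnat
    have h := hreal.trans (circuit_size_le hn hε hε1 hk₂)
    have hnn : 0 ≤ (D.size : ℝ) := Nat.cast_nonneg _
    linarith
  · obtain ⟨φ, hφ, hsize⟩ := exists_formula_xorConstruction hn0 (Nat.mul_pos hn0 hk0) A fs
    refine ⟨φ, hφ, le_trans ?_ (formula_size_le hn hε hε1 hk₂)⟩
    have hreal : (φ.size : ℝ) ≤ 72 * (n * k) ^ 2 * n ^ 2 * 2 ^ (k + 1) := by exact_mod_cast hsize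
    exact hreal.trans_eq (by ring)
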